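/- All graphs are finite, undirected, without loops or multiple edges. For a vertex $x$ of a graph $\Gamma$ let $\Gamma_i(x)$ be the set of vertices at distance $i$ from $x$. A graph $\Gamma$ is *distance-regularized* if it is connected (in particular non-empty) and, for every vertex $x$ and every $i\ge 0$, each of the numbers $c_i(x,y)=|\Gamma_{i-1}(x)\cap\Gamma_1(y)|$ (with $c_0(x,y)=0$), $a_i(x,y)=|\Gamma_i(x)\cap\Gamma_1(y)|$ and $b_i(x,y)=|\Gamma_{i+1}(x)\cap\Gamma_1(y)|$ is the same for all $y\in\Gamma_i(x)$. Two graphs are *cospectral* if their adjacency matrices have the same multiset of eigenvalues, counted with multiplicities. The logic $C^3$ consists of the first-order formulas with equality and one binary relation symbol, interpreted as adjacency, that use only three distinct variables (which may be requantified), with additional counting quantifiers $\exists^{\ge i}$ for every positive integer $i$, where $\exists^{\ge i}x\,\varphi$ says that at least $i$ distinct vertices $x$ satisfy $\varphi$. Two graphs are *$C^3$-equivalent* if they satisfy exactly the same sentences of $C^3$. **Theorem.** Let $\Gamma$ and $\Delta$ be distance-regularized graphs. Then $\Gamma$ and $\Delta$ are cospectral if and only if they are $C^3$-equivalent. -/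

import Mathlib

/-! ### Counting logic with finitely many variables -/

/-- Formulas of the `k`-variable counting logic `C^k` in the language of graphs: first-order
formulas (with equality) in the `k` variables indexed by `Fin k`, with one binary relation symbol
and the counting quantifiers `∃^{≥ n} x` for positive integers `n`. Variables may be requantified
inside the scope of a quantifier. -/
inductive CountingFormula (k : ℕ) : Type
  | equal (i j : Fin k) : CountingFormula k
  | adj (i j : Fin k) : CountingFormula k
  | neg (φ : CountingFormula k) : CountingFormula k
  | or (φ ψ : CountingFormula k) : CountingFormula k
  | and (φ ψ : CountingFormula k) : CountingFormula k
  | imp (φ ψ : CountingFormula k) : CountingFormula k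
  | iff (φ ψ : CountingFormula k) : CountingFormula k
  | ex (i : Fin k) (φ : CountingFormula k) : CountingFormula k
  | all (i : Fin k) (φ : CountingFormula k) : CountingFormula k
  | atLeast (n : ℕ+) (i : Fin k) (φ : CountingFormula k) : CountingFormula k

namespace CountingFormula

/-- The variables that occur free in a formula. -/
def freeVars {k : ℕ} : CountingFormula k → Finset (Fin k)
  | equal i j => {i, j}
  | adj i j => {i, j}
  | neg φ => φ.freeVars
  | or φ ψ => φ.freeVars ∪ ψ.freeVars
  | and φ ψ => φ.freeVars ∪ ψ.freeVars
  | imp φ ψ => φ.freeVars ∪ ψ.freeVars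
  | iff φ ψ => φ.freeVars ∪ ψ.freeVars
  | ex i φ => φ.freeVars.erase i
  | all i φ => φ.freeVars.erase i
  | atLeast _ i φ => φ.freeVars.erase i

/-- A sentence is a formula without free variables. -/
def IsSentence {k : ℕ} (φ : CountingFormula k) : Prop :=
  φ.freeVars = ∅

/-- Satisfaction of a formula in the graph `G` under an assignment `v` of vertices to the
variables. The formula `∃^{≥ n} x φ` holds if at least `n` distinct vertices can be substituted
for `x` to make `φ` true. -/
def Holds {V : Type*} (G : SimpleGraph V) {k : ℕ} : CountingFormula k → (Fin k → V) → Prop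
  | equal i j, v => v i = v j
  | adj i j, v => G.Adj (v i) (v j)
  | neg φ, v => ¬ φ.Holds G v
  | or φ ψ, v => φ.Holds G v ∨ ψ.Holds G v
  | and φ ψ, v => φ.Holds G v ∧ ψ.Holds G v
  | imp φ ψ, v => φ.Holds G v → ψ.Holds G v
  | iff φ ψ, v => (φ.Holds G v ↔ ψ.Holds G v)
  | ex i φ, v => ∃ a : V, φ.Holds G (Function.update v i a)
  | all i φ, v => ∀ a : V, φ.Holds G (Function.update v i a)
  | atLeast n i φ, v => ((n : ℕ) : ℕ∞) ≤ {a : V | φ.Holds G (Function.update v i a)}.encard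

/-- Satisfaction depends only on the values of the free variables. -/
theorem holds_congr {V : Type*} (G : SimpleGraph V) {k : ℕ} (φ : CountingFormula k) :
    ∀ v w : Fin k → V, (∀ i ∈ φ.freeVars, v i = w i) → (φ.Holds G v ↔ φ.Holds G w) := by
  have key : ∀ (i : Fin k) (s : Finset (Fin k)) (v w : Fin k → V) (a : V),
      (∀ j ∈ s.erase i, v j = w j) →
      ∀ j ∈ s, Function.update v i a j = Function.update w i a j := by
    intro i s v w a h j hj
    by_cases hji : j = i
    · subst hji; simp
    · simp [hji, h j (Finset.mem_erase.2 ⟨hji, hj⟩)]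
  induction φ with
  | equal i j => intro v w h; simp [Holds, h i (by simp [freeVars]), h j (by simp [freeVars])]
  | adj i j => intro v w h; simp [Holds, h i (by simp [freeVars]), h j (by simp [freeVars])]
  | neg φ ih => intro v w h; exact not_congr (ih v w h)
  | or φ ψ ih₁ ih₂ =>
    intro v w h
    exact or_congr (ih₁ v w fun i hi => h i (Finset.mem_union_left _ hi))
      (ih₂ v w fun i hi => h i (Finset.mem_union_right _ hi))
  | and φ ψ ih₁ ih₂ =>
    intro v w h
    exact and_congr (ih₁ v w fun i hi => h i (Finset.mem_union_left _ hi))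
      (ih₂ v w fun i hi => h i (Finset.mem_union_right _ hi))
  | imp φ ψ ih₁ ih₂ =>
    intro v w h
    exact imp_congr (ih₁ v w fun i hi => h i (Finset.mem_union_left _ hi))
      (ih₂ v w fun i hi => h i (Finset.mem_union_right _ hi))
  | iff φ ψ ih₁ ih₂ =>
    intro v w h
    exact iff_congr (ih₁ v w fun i hi => h i (Finset.mem_union_left _ hi))
      (ih₂ v w fun i hi => h i (Finset.mem_union_right _ hi))
  | ex i φ ih => intro v w h; exact exists_congr fun a => ih _ _ (key i _ v w a h)
  | all i φ ih => intro v w h; exact forall_congr' fun a => ih _ _ (key i _ v w a h)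
  | atLeast n i φ ih =>
    intro v w h
    have : ∀ a, φ.Holds G (Function.update v i a) ↔ φ.Holds G (Function.update w i a) :=
      fun a => ih _ _ (key i _ v w a h)
    simp only [Holds, this]

end CountingFormula

namespace SimpleGraph

/-- The sentence `φ` is true in the (nonempty) graph `G`. By `CountingFormula.holds_congr` the
assignment is immaterial for a sentence. -/
def Satisfies {V : Type*} (G : SimpleGraph V) {k : ℕ} (φ : CountingFormula k) : Prop :=
  ∀ v : Fin k → V, φ.Holds G v

/-- `C^k`-equivalence: the two graphs satisfy exactly the same sentences of `C^k`. -/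
def CountingEquivalent (k : ℕ) {V W : Type*} (G : SimpleGraph V) (H : SimpleGraph W) : Prop :=
  ∀ φ : CountingFormula k, φ.IsSentence → (G.Satisfies φ ↔ H.Satisfies φ)

/-! ### Spectra -/

/-- The spectrum of a finite graph: the multiset of eigenvalues of its adjacency matrix, counted
with multiplicity. The matrix is real symmetric, so all its eigenvalues are real. -/
noncomputable def graphSpectrum {V : Type*} [Fintype V] [DecidableEq V] (G : SimpleGraph V)
    [DecidableRel G.Adj] : Multiset ℝ :=
  (G.adjMatrix ℝ).charpoly.roots

/-- Two finite graphs are cospectral if they have the same spectrum. -/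
def Cospectral {V W : Type*} [Fintype V] [DecidableEq V] [Fintype W] [DecidableEq W]
    (G : SimpleGraph V) [DecidableRel G.Adj] (H : SimpleGraph W) [DecidableRel H.Adj] : Prop :=
  G.graphSpectrum = H.graphSpectrum

/-! ### Distance-regularized graphs -/

/-- `Γ_i(x)`: the set of vertices at distance `i` from `x`. -/
def distSphere {V : Type*} (G : SimpleGraph V) (i : ℕ) (x : V) : Set V :=
  {y | G.edist x y = (i : ℕ∞)}

/-- `c_i(x, y) = |Γ_{i-1}(x) ∩ Γ_1(y)|`, and `c_0(x, y) = 0`. -/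
noncomputable def cNumber {V : Type*} (G : SimpleGraph V) : ℕ → V → V → ℕ
  | 0, _, _ => 0
  | i + 1, x, y => (G.distSphere i x ∩ G.distSphere 1 y).ncard

/-- `a_i(x, y) = |Γ_i(x) ∩ Γ_1(y)|`. -/
noncomputable def aNumber {V : Type*} (G : SimpleGraph V) (i : ℕ) (x y : V) : ℕ :=
  (G.distSphere i x ∩ G.distSphere 1 y).ncard

/-- `b_i(x, y) = |Γ_{i+1}(x) ∩ Γ_1(y)|`. -/
noncomputable def bNumber {V : Type*} (G : SimpleGraph V) (i : ℕ) (x y : V) : ℕ :=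
  (G.distSphere (i + 1) x ∩ G.distSphere 1 y).ncard

/-- The vertex `x` is distance-regularized: for every `i`, the numbers `c_i(x, y)`, `a_i(x, y)`
and `b_i(x, y)` do not depend on the choice of `y ∈ Γ_i(x)`. -/
def IsDistanceRegularizedVertex {V : Type*} (G : SimpleGraph V) (x : V) : Prop :=
  ∀ i : ℕ, ∀ y ∈ G.distSphere i x, ∀ z ∈ G.distSphere i x,
    G.cNumber i x y = G.cNumber i x z ∧
      G.aNumber i x y = G.aNumber i x z ∧
      G.bNumber i x y = G.bNumber i x z

/-- A distance-regularized graph: a connected graph all of whose vertices are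
distance-regularized. -/
def IsDistanceRegularized {V : Type*} (G : SimpleGraph V) : Prop :=
  G.Connected ∧ ∀ x : V, G.IsDistanceRegularizedVertex x

end SimpleGraph

/-! ### Counting types and bijective back-and-forth -/

namespace CountingFormula

theorem holds_iff_of_backAndForth {V W : Type*} {k : ℕ} (G : SimpleGraph V) (H : SimpleGraph W)
    (R : (Fin k → V) → (Fin k → W) → Prop)
    (heq : ∀ v w, R v w → ∀ i j, v i = v j ↔ w i = w j)
    (hadj : ∀ v w, R v w → ∀ i j, G.Adj (v i) (v j) ↔ H.Adj (w i) (w j))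
    (hext : ∀ v w, R v w → ∀ i, ∃ f : V ≃ W,
      ∀ a, R (Function.update v i a) (Function.update w i (f a)))
    (φ : CountingFormula k) : ∀ v w, R v w → (φ.Holds G v ↔ φ.Holds H w) := by
  induction φ with
  | equal i j => exact fun v w h => heq v w h i j
  | adj i j => exact fun v w h => hadj v w h i j
  | neg φ ih => exact fun v w h => not_congr (ih v w h)
  | or φ ψ ih₁ ih₂ => exact fun v w h => or_congr (ih₁ v w h) (ih₂ v w h)
  | and φ ψ ih₁ ih₂ => exact fun v w h => and_congr (ih₁ v w h) (ih₂ v w h)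
  | imp φ ψ ih₁ ih₂ => exact fun v w h => imp_congr (ih₁ v w h) (ih₂ v w h)
  | iff φ ψ ih₁ ih₂ => exact fun v w h => iff_congr (ih₁ v w h) (ih₂ v w h)
  | ex i φ ih =>
    intro v w h
    obtain ⟨f, hf⟩ := hext v w h i
    exact f.exists_congr fun a => ih _ _ (hf a)
  | all i φ ih =>
    intro v w h
    obtain ⟨f, hf⟩ := hext v w h i
    exact f.forall_congr fun a => ih _ _ (hf a)
  | atLeast n i φ ih =>
    intro v w h
    obtain ⟨f, hf⟩ := hext v w h i
    have : {b : W | φ.Holds H (Function.update w i b)} =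
        f '' {a : V | φ.Holds G (Function.update v i a)} := by
      ext b
      obtain ⟨a, rfl⟩ := f.surjective b
      simpa using (ih _ _ (hf a)).symm
    simp only [Holds, this, f.injective.encard_image]

/-- The conjunction of a list of formulas. -/
def listAnd {k : ℕ} [NeZero k] (l : List (CountingFormula k)) : CountingFormula k :=
  l.foldr and (equal 0 0)

theorem holds_listAnd {V : Type*} (G : SimpleGraph V) {k : ℕ} [NeZero k]
    (l : List (CountingFormula k)) (v : Fin k → V) :
    (listAnd l).Holds G v ↔ ∀ φ ∈ l, φ.Holds G v := by
  induction l with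
  | nil => simp [listAnd, Holds]
  | cons φ l ih => simpa [listAnd, Holds] using fun _ => ih

/-- Two tuples of vertices, of possibly different graphs, satisfy the same formulas. -/
def SameType {V W : Type*} {k : ℕ} (G : SimpleGraph V) (v : Fin k → V) (H : SimpleGraph W)
    (w : Fin k → W) : Prop :=
  ∀ φ : CountingFormula k, φ.Holds G v ↔ φ.Holds H w

theorem SameType.symm {V W : Type*} {k : ℕ} {G : SimpleGraph V} {v : Fin k → V}
    {H : SimpleGraph W} {w : Fin k → W} (h : SameType G v H w) : SameType H w G v :=
  fun φ => (h φ).symm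

/-- On finitely many tuples, every tuple has a formula that isolates it up to `SameType`. -/
theorem exists_isolating {U V : Type*} [Finite V] {k : ℕ} [NeZero k] (K : SimpleGraph U)
    (u : Fin k → U) (G : SimpleGraph V) :
    ∃ χ : CountingFormula k, χ.Holds K u ∧
      ∀ v : Fin k → V, χ.Holds G v → SameType K u G v := by
  classical
  have sep : ∀ v : Fin k → V, ∃ φ : CountingFormula k, φ.Holds K u ∧
      (φ.Holds G v → SameType K u G v) := by
    intro v
    by_cases h : SameType K u G v
    · exact ⟨listAnd [], by simp [holds_listAnd], fun _ => h⟩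
    · obtain ⟨φ, hφ⟩ := not_forall.1 h
      by_cases hu : φ.Holds K u
      · exact ⟨φ, hu, fun hv => absurd (iff_of_true hu hv) hφ⟩
      · exact ⟨neg φ, hu, fun hv => absurd (iff_of_false hu hv) hφ⟩
  choose φ hu hv using sep
  have := Fintype.ofFinite V
  refine ⟨listAnd ((Finset.univ : Finset (Fin k → V)).toList.map φ), ?_, fun v h => ?_⟩
  · rw [holds_listAnd]
    intro ψ hψ
    obtain ⟨v, -, rfl⟩ := List.mem_map.1 hψ
    exact hu v
  · rw [holds_listAnd] at h
    exact hv v (h _ (List.mem_map.2 ⟨v, by simp, rfl⟩))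

theorem SameType.encard_eq {V W : Type*} [Finite V] [Finite W] {k : ℕ} {G : SimpleGraph V}
    {v : Fin k → V} {H : SimpleGraph W} {w : Fin k → W} (h : SameType G v H w) (i : Fin k)
    (φ : CountingFormula k) :
    {a : V | φ.Holds G (Function.update v i a)}.encard =
      {b : W | φ.Holds H (Function.update w i b)}.encard := by
  have key : ∀ n : ℕ, (n : ℕ∞) ≤ {a : V | φ.Holds G (Function.update v i a)}.encard ↔
      (n : ℕ∞) ≤ {b : W | φ.Holds H (Function.update w i b)}.encard := by
    intro n
    rcases Nat.eq_zero_or_pos n with rfl | hn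
    · simp
    · exact h (atLeast ⟨n, hn⟩ i φ)
  have hV := (Set.toFinite {a : V | φ.Holds G (Function.update v i a)}).cast_ncard_eq
  have hW := (Set.toFinite {b : W | φ.Holds H (Function.update w i b)}).cast_ncard_eq
  apply le_antisymm
  · rw [← hV, ← key, hV]
  · rw [← hW, key, hW]

/-- The formulas satisfied by a tuple of vertices. -/
def typeOf {V : Type*} {k : ℕ} (G : SimpleGraph V) (v : Fin k → V) :
    CountingFormula k → Prop :=
  fun φ => φ.Holds G v

theorem typeOf_eq_iff {V W : Type*} {k : ℕ} {G : SimpleGraph V} {v : Fin k → V}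
    {H : SimpleGraph W} {w : Fin k → W} : typeOf G v = typeOf H w ↔ SameType G v H w := by
  simp [funext_iff, typeOf, SameType]

/-- The conjunction of formulas isolating `u` relative to `G` and to `H` defines the type of `u` in
both graphs, so its solutions are equinumerous. The separate graph `K` lets the type come from
either side. -/
theorem SameType.nonempty_fiber_equiv {U V W : Type*} [Finite V] [Finite W] {k : ℕ} [NeZero k]
    {G : SimpleGraph V} {v : Fin k → V} {H : SimpleGraph W} {w : Fin k → W}
    (h : SameType G v H w) (i : Fin k) (K : SimpleGraph U) (u : Fin k → U) :
    Nonempty ({a // typeOf G (Function.update v i a) = typeOf K u} ≃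
      {b // typeOf H (Function.update w i b) = typeOf K u}) := by
  obtain ⟨χ₁, hu₁, h₁⟩ := exists_isolating K u G
  obtain ⟨χ₂, hu₂, h₂⟩ := exists_isolating K u H
  have hG : ∀ a, (and χ₁ χ₂).Holds G (Function.update v i a) ↔
      typeOf G (Function.update v i a) = typeOf K u := fun a => by
    rw [typeOf_eq_iff]
    exact ⟨fun ha => (h₁ _ ha.1).symm, fun ha => ⟨(ha χ₁).2 hu₁, (ha χ₂).2 hu₂⟩⟩
  have hH : ∀ b, (and χ₁ χ₂).Holds H (Function.update w i b) ↔
      typeOf H (Function.update w i b) = typeOf K u := fun b => by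
    rw [typeOf_eq_iff]
    exact ⟨fun hb => (h₂ _ hb.2).symm, fun hb => ⟨(hb χ₁).2 hu₁, (hb χ₂).2 hu₂⟩⟩
  have := h.encard_eq i (and χ₁ χ₂)
  simp only [hG, hH] at this
  rw [Set.encard, Set.encard, ENat.card_eq_coe_natCard, ENat.card_eq_coe_natCard] at this
  exact ⟨(Finite.equivFin _).trans
    ((finCongr (by exact_mod_cast this)).trans (Finite.equivFin _).symm)⟩

theorem SameType.exists_equiv {V W : Type*} [Finite V] [Finite W] {k : ℕ} [NeZero k]
    {G : SimpleGraph V} {v : Fin k → V} {H : SimpleGraph W} {w : Fin k → W}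
    (h : SameType G v H w) (i : Fin k) :
    ∃ f : V ≃ W, ∀ a, SameType G (Function.update v i a) H (Function.update w i (f a)) := by
  have fiber : ∀ c, Nonempty ({a // typeOf G (Function.update v i a) = c} ≃
      {b // typeOf H (Function.update w i b) = c}) := by
    intro c
    by_cases hV : ∃ a, typeOf G (Function.update v i a) = c
    · obtain ⟨a, rfl⟩ := hV
      exact h.nonempty_fiber_equiv i G _
    by_cases hW : ∃ b, typeOf H (Function.update w i b) = c
    · obtain ⟨b, rfl⟩ := hW
      exact h.nonempty_fiber_equiv i H _
    have := Subtype.isEmpty_of_false (not_exists.1 hV)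
    have := Subtype.isEmpty_of_false (not_exists.1 hW)
    exact ⟨Equiv.equivOfIsEmpty _ _⟩
  refine ⟨Equiv.ofFiberEquiv fun c => (fiber c).some, fun a => ?_⟩
  exact typeOf_eq_iff.1 (Equiv.ofFiberEquiv_map (fun c => (fiber c).some) a).symm

end CountingFormula

/-! ### `C^3`-equivalence preserves walk counts -/

namespace SimpleGraph

open CountingFormula

theorem satisfies_iff_holds {V : Type*} (G : SimpleGraph V) {k : ℕ} {φ : CountingFormula k}
    (hφ : φ.IsSentence) (v : Fin k → V) : G.Satisfies φ ↔ φ.Holds G v :=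
  ⟨fun h => h v, fun h w => (φ.holds_congr G v w
    (by simp [show φ.freeVars = ∅ from hφ])).1 h⟩

theorem CountingEquivalent.exists_sameType {V W : Type*} [Finite W] [Nonempty V]
    [Nonempty W] {G : SimpleGraph V} {H : SimpleGraph W} (h : G.CountingEquivalent 3 H)
    (v : Fin 3 → V) : ∃ w : Fin 3 → W, SameType G v H w := by
  obtain ⟨χ, hv, hχ⟩ := exists_isolating G v H
  have hs : (ex 0 (ex 1 (ex 2 χ))).IsSentence := by
    ext i
    fin_cases i <;> simp [freeVars]
  have hG : (ex 0 (ex 1 (ex 2 χ))).Holds G v := by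
    refine ⟨v 0, v 1, v 2, ?_⟩
    simpa only [Function.update_eq_self] using hv
  have w₀ : Fin 3 → W := fun _ => Classical.arbitrary W
  obtain ⟨a, b, c, hw⟩ := (satisfies_iff_holds H hs w₀).1
    ((h _ hs).1 ((satisfies_iff_holds G hs v).2 hG))
  exact ⟨_, hχ _ hw⟩

section Walks

variable {V W : Type*} [Fintype V] [DecidableEq V] [Fintype W] [DecidableEq W]
  {G : SimpleGraph V} [DecidableRel G.Adj] {H : SimpleGraph W} [DecidableRel H.Adj]

theorem adjMatrix_pow_apply_eq_of_sameType (n : ℕ) : ∀ (v : Fin 3 → V) (w : Fin 3 → W),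
    SameType G v H w → ∀ i j,
      (G.adjMatrix ℝ ^ n) (v i) (v j) = (H.adjMatrix ℝ ^ n) (w i) (w j) := by
  induction n with
  | zero =>
    intro v w h i j
    have : v i = v j ↔ w i = w j := h (equal i j)
    simp [Matrix.one_apply, this]
  | succ n ih =>
    intro v w h i j
    -- This is where three variables are needed: `l` is free to hold the second vertex of a walk
    -- from `v i` to `v j`.
    obtain ⟨l, hli, hlj⟩ : ∃ l : Fin 3, l ≠ i ∧ l ≠ j := by decide +revert
    obtain ⟨f, hf⟩ := h.exists_equiv l
    rw [pow_succ', pow_succ', Matrix.mul_apply, Matrix.mul_apply, ← f.sum_comp]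
    refine Finset.sum_congr rfl fun a _ => ?_
    have h₁ := ih _ _ (hf a) l j
    have h₂ : G.Adj (v i) a ↔ H.Adj (w i) (f a) := by
      simpa [Holds, hli.symm] using hf a (adj i l)
    simp only [Function.update_self, Function.update_of_ne hlj.symm] at h₁
    simp [h₁, h₂]

theorem CountingEquivalent.trace_pow_eq [Nonempty V] [Nonempty W]
    (h : G.CountingEquivalent 3 H) (n : ℕ) :
    (G.adjMatrix ℝ ^ n).trace = (H.adjMatrix ℝ ^ n).trace := by
  obtain ⟨w, hw⟩ := h.exists_sameType fun _ => Classical.arbitrary V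
  obtain ⟨f, hf⟩ := hw.exists_equiv 0
  rw [Matrix.trace, Matrix.trace, ← f.sum_comp]
  exact Finset.sum_congr rfl fun a _ => by
    simpa using adjMatrix_pow_apply_eq_of_sameType n _ _ (hf a) 0 0

end Walks

end SimpleGraph

/-! ### Spectra and traces of polynomials -/

open Polynomial in
theorem Matrix.IsHermitian.trace_aeval {n : Type*} [Fintype n] [DecidableEq n]
    {A : Matrix n n ℝ} (hA : A.IsHermitian) (p : ℝ[X]) :
    (aeval A p).trace = (A.charpoly.roots.map fun t => p.eval t).sum := by
  have h₁ : aeval A p = Unitary.conjStarAlgAut ℝ (Matrix n n ℝ) hA.eigenvectorUnitary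
      (aeval (diagonalAlgHom ℝ hA.eigenvalues) p) := by
    conv_lhs => rw [hA.spectral_theorem]
    exact aeval_algHom_apply (Unitary.conjStarAlgAut ℝ (Matrix n n ℝ)
      hA.eigenvectorUnitary).toAlgEquiv.toAlgHom (diagonalAlgHom ℝ hA.eigenvalues) p
  rw [h₁, aeval_algHom_apply, Unitary.conjStarAlgAut_apply, trace_mul_comm, ← mul_assoc,
    Unitary.coe_star_mul_self, one_mul, hA.roots_charpoly_eq_eigenvalues, Multiset.map_map]
  rw [show (diagonalAlgHom ℝ (aeval hA.eigenvalues p)).trace = ∑ i, aeval hA.eigenvalues p i from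
    trace_diagonal _]
  simp only [aeval_pi_apply₂, coe_aeval_eq_eval]
  rfl

open Polynomial in
-- The Lagrange polynomial that is `1` at `a` and `0` at all other elements of `s` and `t` turns the
-- sums into the multiplicities of `a`.
theorem Multiset.eq_of_sum_map_eval_eq {K : Type*} [Field K] [CharZero K] (s t : Multiset K)
    (h : ∀ p : K[X], (s.map fun a => p.eval a).sum = (t.map fun a => p.eval a).sum) : s = t := by
  classical
  ext a
  let S := s.toFinset ∪ t.toFinset
  let p := Lagrange.interpolate S id (Pi.single a (1 : K))
  have key : ∀ u : Multiset K, u.toFinset ⊆ S →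
      (u.map fun b => p.eval b).sum = (u.count a : K) := by
    intro u hu
    rw [Multiset.map_congr rfl (g := fun b => if a = b then (1 : K) else 0)]
    · rw [Multiset.count_eq_card_filter_eq, ← Multiset.countP_eq_card_filter]
      clear hu
      induction u using Multiset.induction with
      | empty => simp
      | cons b u ih =>
        rw [Multiset.map_cons, Multiset.sum_cons, ih, Multiset.countP_cons]
        push_cast
        ring
    · intro b hb
      have := Lagrange.eval_interpolate_at_node (Pi.single a (1 : K)) (Set.injOn_id (S : Set K))
        (hu (Multiset.mem_toFinset.2 hb))
      simp only [id] at this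
      rw [this, Pi.single_apply]
      simp [eq_comm]
  have := h p
  rw [key s Finset.subset_union_left, key t Finset.subset_union_right] at this
  exact_mod_cast this

namespace SimpleGraph

open Polynomial

variable {V W : Type*} [Fintype V] [DecidableEq V] [Fintype W] [DecidableEq W]
  {G : SimpleGraph V} [DecidableRel G.Adj] {H : SimpleGraph W} [DecidableRel H.Adj]

theorem cospectral_iff_trace_aeval : G.Cospectral H ↔
    ∀ p : ℝ[X], (aeval (G.adjMatrix ℝ) p).trace = (aeval (H.adjMatrix ℝ) p).trace := by
  have hG : (G.adjMatrix ℝ).IsHermitian := G.isHermitian_adjMatrix ℝ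
  have hH : (H.adjMatrix ℝ).IsHermitian := H.isHermitian_adjMatrix ℝ
  simp only [hG.trace_aeval, hH.trace_aeval]
  exact ⟨fun h p => by
      rw [show (G.adjMatrix ℝ).charpoly.roots = (H.adjMatrix ℝ).charpoly.roots from h],
    Multiset.eq_of_sum_map_eval_eq _ _⟩

theorem CountingEquivalent.cospectral [Nonempty V] [Nonempty W]
    (h : G.CountingEquivalent 3 H) : G.Cospectral H := by
  refine cospectral_iff_trace_aeval.2 fun p => ?_
  simp only [aeval_eq_sum_range, Matrix.trace_sum, Matrix.trace_smul, h.trace_pow_eq]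

end SimpleGraph

/-! ### Intersection arrays and distance polynomials -/

namespace SimpleGraph

open Polynomial Finset

theorem mem_distSphere_iff {V : Type*} {G : SimpleGraph V} (hG : G.Connected) {i : ℕ} {x y : V} :
    y ∈ G.distSphere i x ↔ G.dist x y = i := by
  rw [distSphere, Set.mem_ofPred_eq, ← (hG.preconnected x y).coe_dist_eq_edist]
  norm_cast

variable {V : Type*} [Fintype V] {G : SimpleGraph V} [DecidableRel G.Adj]

theorem ncard_distSphere_inter (hG : G.Connected) (i : ℕ) (x y : V) :
    (G.distSphere i x ∩ G.distSphere 1 y).ncard =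
      #{z ∈ G.neighborFinset y | G.dist x z = i} := by
  rw [← Set.ncard_coe_finset]
  congr 1
  ext z
  simp [mem_distSphere_iff hG, dist_eq_one_iff_adj, and_comm]

theorem sum_neighborFinset_comp_dist {R : Type*} [Semiring R] (x y : V) (F : ℕ → R) :
    ∑ z ∈ G.neighborFinset y, F (G.dist x z) =
      (if G.dist x y = 0 then 0 else
        #{z ∈ G.neighborFinset y | G.dist x z = G.dist x y - 1} * F (G.dist x y - 1)) +
      #{z ∈ G.neighborFinset y | G.dist x z = G.dist x y} * F (G.dist x y) +
      #{z ∈ G.neighborFinset y | G.dist x z = G.dist x y + 1} * F (G.dist x y + 1) := by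
  have key : ∀ j, (#{z ∈ G.neighborFinset y | G.dist x z = j} : R) * F j =
      ∑ z ∈ G.neighborFinset y, if G.dist x z = j then F (G.dist x z) else 0 := by
    intro j
    rw [← sum_filter, sum_congr rfl (g := fun _ => F j) (fun z hz => by rw [(mem_filter.1 hz).2]),
      sum_const, nsmul_eq_mul]
  -- Truncated subtraction would make the first term repeat the second when `y = x`; the condition
  -- `dist + 1 = dist` avoids this.
  have h₀ : (if G.dist x y = 0 then 0 else
      #{z ∈ G.neighborFinset y | G.dist x z = G.dist x y - 1} * F (G.dist x y - 1)) =
      ∑ z ∈ G.neighborFinset y, if G.dist x z + 1 = G.dist x y then F (G.dist x z) else 0 := by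
    split_ifs with h
    · exact (sum_eq_zero fun z _ => if_neg (by omega)).symm
    · rw [key]
      exact sum_congr rfl fun z _ => if_congr (by omega) rfl rfl
  rw [h₀, key, key, ← sum_add_distrib, ← sum_add_distrib]
  refine sum_congr rfl fun z hz => ?_
  have := (show G.Adj y z by simpa using hz).diff_dist_adj (u := x)
  split_ifs <;> first | omega | simp

/-- Summation over neighbours acts on functions of the distance from `x` as a tridiagonal matrix,
with entries `c i`, `a i`, `b i` in row `i`. -/
structure HasIntersectionArray (G : SimpleGraph V) [DecidableRel G.Adj] (x : V)
    (c a b : ℕ → ℝ) : Prop where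
  sum_eq : ∀ (y : V) (F : ℕ → ℝ), ∑ z ∈ G.neighborFinset y, F (G.dist x z) =
    c (G.dist x y) * F (G.dist x y - 1) + a (G.dist x y) * F (G.dist x y) +
      b (G.dist x y) * F (G.dist x y + 1)
  c_zero : c 0 = 0
  c_pos : ∀ y, y ≠ x → 0 < c (G.dist x y)

theorem HasIntersectionArray.degree_eq {x : V} {c a b : ℕ → ℝ}
    (hx : G.HasIntersectionArray x c a b) (y : V) :
    (G.degree y : ℝ) = c (G.dist x y) + a (G.dist x y) + b (G.dist x y) := by
  simpa using hx.sum_eq y fun _ => 1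

theorem sum_mul_sum_neighborFinset (f g : V → ℝ) :
    ∑ y, f y * ∑ z ∈ G.neighborFinset y, g z = ∑ y, g y * ∑ z ∈ G.neighborFinset y, f z := by
  simp only [← adjMatrix_mulVec_apply]
  change f ⬝ᵥ (G.adjMatrix ℝ).mulVec g = g ⬝ᵥ (G.adjMatrix ℝ).mulVec f
  rw [Matrix.dotProduct_mulVec, ← Matrix.mulVec_transpose, transpose_adjMatrix, dotProduct_comm]

/-- Both sides count the edges between the spheres of radius `i` and `i + 1`; formally, `A` is
symmetric and is applied to their indicators. -/
theorem HasIntersectionArray.sum_sphere_mul {x : V} {c a b : ℕ → ℝ}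
    (hx : G.HasIntersectionArray x c a b) (i : ℕ) :
    (∑ y, if G.dist x y = i + 1 then (1 : ℝ) else 0) * c (i + 1) =
      (∑ y, if G.dist x y = i then (1 : ℝ) else 0) * b i := by
  have := sum_mul_sum_neighborFinset (G := G) (fun y => if G.dist x y = i + 1 then 1 else 0)
    fun y => if G.dist x y = i then 1 else 0
  have h₁ := fun y => hx.sum_eq y fun j => if j = i then 1 else 0
  have h₂ := fun y => hx.sum_eq y fun j => if j = i + 1 then 1 else 0
  simp only [h₁, h₂] at this
  rw [sum_mul, sum_mul]
  convert this using 2 with y _ y _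
  · by_cases h : G.dist x y = i + 1 <;> simp [h, show i + 1 + 1 ≠ i by omega]
  · by_cases h : G.dist x y = i
    · by_cases h' : i = 0 <;> simp [h, h', show i - 1 ≠ i + 1 by omega]
    · simp [h]

theorem IsDistanceRegularizedVertex.exists_hasIntersectionArray (hG : G.Connected) {x : V}
    (hx : G.IsDistanceRegularizedVertex x) : ∃ c a b : ℕ → ℝ, G.HasIntersectionArray x c a b := by
  have exists_fun : ∀ f : ℕ → V → V → ℕ, (∀ i, ∀ y ∈ G.distSphere i x, ∀ z ∈ G.distSphere i x,
      f i x y = f i x z) → ∃ g : ℕ → ℕ, ∀ y, f (G.dist x y) x y = g (G.dist x y) := by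
    intro f hf
    refine ⟨fun i => if h : ∃ y, G.dist x y = i then f i x h.choose else 0, fun y => ?_⟩
    have h : ∃ z, G.dist x z = G.dist x y := ⟨y, rfl⟩
    simp only [dif_pos h]
    exact hf _ _ ((mem_distSphere_iff hG).2 rfl) _ ((mem_distSphere_iff hG).2 h.choose_spec)
  obtain ⟨c, hc⟩ := exists_fun G.cNumber fun i y hy z hz => (hx i y hy z hz).1
  obtain ⟨a, ha⟩ := exists_fun G.aNumber fun i y hy z hz => (hx i y hy z hz).2.1
  obtain ⟨b, hb⟩ := exists_fun G.bNumber fun i y hy z hz => (hx i y hy z hz).2.2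
  refine ⟨fun i => c i, fun i => a i, fun i => b i, fun y F => ?_, ?_, fun y hy => ?_⟩
  · rw [sum_neighborFinset_comp_dist, ← hc, ← ha, ← hb, aNumber, bNumber,
      ncard_distSphere_inter hG, ncard_distSphere_inter hG]
    congr 2
    split_ifs with h
    · simp [h, cNumber]
    · obtain ⟨j, hj⟩ := Nat.exists_eq_succ_of_ne_zero h
      rw [hj, cNumber, ncard_distSphere_inter hG, Nat.succ_sub_one]
  · have := hc x
    rw [dist_self] at this
    simp [← this, cNumber]
  · have hpos := hG.pos_dist_of_ne hy.symm
    obtain ⟨j, hj⟩ := Nat.exists_eq_succ_of_ne_zero hpos.ne'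
    rw [Nat.cast_pos, ← hc, hj, cNumber, ncard_distSphere_inter hG, card_pos]
    -- The second vertex of a shortest walk from `y` to `x` is a neighbour one step closer to `x`.
    obtain ⟨p, hp⟩ := hG.exists_walk_length_eq_dist y x
    cases p with
    | nil => exact absurd rfl hy
    | @cons _ z _ h q =>
      refine ⟨z, mem_filter.2 ⟨by simpa using h, ?_⟩⟩
      have h₁ := dist_le q
      have h₂ := h.diff_dist_adj (u := x)
      rw [Walk.length_cons, dist_comm] at hp
      rw [dist_comm] at h₁
      omega

variable [DecidableEq V]

theorem aeval_adjMatrix_isSymm (p : ℝ[X]) : (aeval (G.adjMatrix ℝ) p).IsSymm := by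
  simp [Matrix.IsSymm, aeval_eq_sum_range, Matrix.transpose_sum]

theorem aeval_adjMatrix_comm (p : ℝ[X]) (x y : V) :
    aeval (G.adjMatrix ℝ) p x y = aeval (G.adjMatrix ℝ) p y x :=
  (aeval_adjMatrix_isSymm p).apply y x

theorem aeval_X_mul_apply (p : ℝ[X]) (y x : V) : aeval (G.adjMatrix ℝ) (X * p) y x =
    ∑ z ∈ G.neighborFinset y, aeval (G.adjMatrix ℝ) p z x := by
  rw [map_mul, aeval_X, adjMatrix_mul_apply]

theorem aeval_mul_apply (p q : ℝ[X]) (y x : V) : aeval (G.adjMatrix ℝ) (p * q) y x =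
    ∑ z, aeval (G.adjMatrix ℝ) p z y * aeval (G.adjMatrix ℝ) q z x := by
  rw [map_mul, Matrix.mul_apply]
  exact sum_congr rfl fun z _ => by rw [aeval_adjMatrix_comm]

/-- Functions of the distance from `x` form a space that contains the unit vector at `x` and is
closed under `A`. -/
theorem HasIntersectionArray.exists_aeval_eq (hG : G.Connected) {x : V} {c a b : ℕ → ℝ}
    (hx : G.HasIntersectionArray x c a b) (p : ℝ[X]) :
    ∃ F : ℕ → ℝ, ∀ y, aeval (G.adjMatrix ℝ) p y x = F (G.dist x y) := by
  induction p using Polynomial.induction_on' with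
  | add p q hp hq =>
    obtain ⟨F, hF⟩ := hp
    obtain ⟨F', hF'⟩ := hq
    exact ⟨fun i => F i + F' i, fun y => by simp [hF, hF']⟩
  | monomial n r =>
    induction n with
    | zero =>
      refine ⟨fun i => if i = 0 then r else 0, fun y => ?_⟩
      simp [Matrix.algebraMap_matrix_apply, hG.dist_eq_zero_iff, eq_comm]
    | succ n ih =>
      obtain ⟨F, hF⟩ := ih
      refine ⟨fun i => c i * F (i - 1) + a i * F i + b i * F (i + 1), fun y => ?_⟩
      rw [← X_mul_monomial, aeval_X_mul_apply]
      exact (sum_congr rfl fun z _ => hF z).trans (hx.sum_eq y F)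

/-- The pairs `(p_{i-1}, p_i)` of consecutive orthogonal polynomials of the moment functional `L`,
normalized by means of the row sums `δ` of the associated tridiagonal matrix. -/
noncomputable def distPolyPair (L : ℝ[X] → ℝ) (δ : ℕ → ℝ) : ℕ → ℝ[X] × ℝ[X]
  | 0 => (0, 1)
  | i + 1 =>
    let p₀ := (distPolyPair L δ i).1
    let p := (distPolyPair L δ i).2
    let b := δ i - L (X * p * p) / L (p * p) - L (X * p * p₀) / L (p * p)
    let q := X * p - C (L (X * p * p) / L (p * p)) * p - C (L (X * p * p₀) / L (p₀ * p₀)) * p₀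
    (p, C (b * L (p * p) / L (q * q)) * q)

/-- Sphere indicators obey a three-term recurrence and are orthogonal, and `L (p * q)` is the inner
product of `p(A) e_x` and `q(A) e_x`. So `L` recovers `a i`, `b (i - 1)` and `c i` as quotients, and
`b i` is what remains of the degree. Then `q(A) e_x` is `c (i + 1)` times the next indicator. Beyond
the last sphere all indicators vanish, so divisions by zero do no harm. -/
theorem HasIntersectionArray.aeval_distPolyPair (hG : G.Connected) {x : V} {c a b : ℕ → ℝ}
    (hx : G.HasIntersectionArray x c a b) {L : ℝ[X] → ℝ}
    (hL : ∀ p, aeval (G.adjMatrix ℝ) p x x = L p) {δ : ℕ → ℝ}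
    (hδ : ∀ y, (G.degree y : ℝ) = δ (G.dist x y)) (i : ℕ) :
    (∀ y, aeval (G.adjMatrix ℝ) (distPolyPair L δ i).1 y x =
        if G.dist x y + 1 = i then 1 else 0) ∧
      ∀ y, aeval (G.adjMatrix ℝ) (distPolyPair L δ i).2 y x =
        if G.dist x y = i then 1 else 0 := by
  induction i with
  | zero =>
    refine ⟨by simp [distPolyPair], fun y => ?_⟩
    simp [distPolyPair, Matrix.one_apply, hG.dist_eq_zero_iff, eq_comm]
  | succ i ih =>
    simp only [distPolyPair]
    generalize (distPolyPair L δ i).1 = p₀ at ih ⊢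
    generalize (distPolyPair L δ i).2 = p at ih ⊢
    obtain ⟨h₀, h⟩ := ih
    refine ⟨by simpa using h, ?_⟩
    have hLmul : ∀ p q, L (p * q) =
        ∑ y, aeval (G.adjMatrix ℝ) p y x * aeval (G.adjMatrix ℝ) q y x := fun p q => by
      rw [← hL, aeval_mul_apply]
    have hXp : ∀ y, aeval (G.adjMatrix ℝ) (X * p) y x =
        c (i + 1) * (if G.dist x y = i + 1 then 1 else 0) +
          a i * (if G.dist x y = i then 1 else 0) +
          b (i - 1) * (if G.dist x y + 1 = i then 1 else 0) := by
      intro y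
      rw [aeval_X_mul_apply, sum_congr rfl fun z _ => h z,
        hx.sum_eq y fun j => if j = i then 1 else 0]
      refine congrArg₂ (· + ·) (congrArg₂ (· + ·) ?_ ?_) ?_
      · rcases Nat.eq_zero_or_pos (G.dist x y) with h | h
        · simp [h, hx.c_zero]
        · by_cases h' : G.dist x y = i + 1
          · simp [h']
          · simp [h', show G.dist x y - 1 ≠ i by omega]
      · by_cases h : G.dist x y = i <;> simp [h]
      · by_cases h : G.dist x y + 1 = i
        · subst h
          simp
        · simp [h]
    have hXp₀ : ∀ y, aeval (G.adjMatrix ℝ) (X * p₀) y x *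
        (if G.dist x y = i then 1 else 0) = c i * (if G.dist x y = i then 1 else 0) := by
      intro y
      rw [aeval_X_mul_apply, sum_congr rfl fun z _ => h₀ z,
        hx.sum_eq y fun j => if j + 1 = i then 1 else 0]
      by_cases h : G.dist x y = i
      · rcases Nat.eq_zero_or_pos i with h' | h'
        · simp [h, h', hx.c_zero]
        · simp [h, Nat.sub_add_cancel h', show ¬ (i + 1 + 1 = i) by omega]
      · simp [h]
    have hpp : L (p * p) = ∑ y, if G.dist x y = i then (1 : ℝ) else 0 := by
      rw [hLmul]
      exact sum_congr rfl fun y _ => by simp [h]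
    have hp₀p₀ : L (p₀ * p₀) = ∑ y, if G.dist x y + 1 = i then (1 : ℝ) else 0 := by
      rw [hLmul]
      exact sum_congr rfl fun y _ => by simp [h₀]
    have ha : L (X * p * p) = a i * L (p * p) := by
      rw [hLmul, hpp, mul_sum]
      refine sum_congr rfl fun y _ => ?_
      rw [hXp, h]
      by_cases h : G.dist x y = i <;> simp [h]
    have hb : L (X * p * p₀) = b (i - 1) * L (p₀ * p₀) := by
      rw [hLmul, hp₀p₀, mul_sum]
      refine sum_congr rfl fun y _ => ?_
      rw [hXp, h₀]
      by_cases h : G.dist x y + 1 = i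
      · simp [h, show G.dist x y ≠ i + 1 by omega, show G.dist x y ≠ i by omega]
      · simp [h]
    have hc : L (X * p * p₀) = c i * L (p * p) := by
      rw [show X * p * p₀ = X * p₀ * p by ring, hLmul, hpp, mul_sum]
      exact sum_congr rfl fun y _ => by rw [h, hXp₀]
    set q := X * p - C (L (X * p * p) / L (p * p)) * p -
      C (L (X * p * p₀) / L (p₀ * p₀)) * p₀ with hq
    have sum_ne_zero : ∀ (P : V → Prop) [DecidablePred P] (y : V), P y →
        (∑ z, if P z then (1 : ℝ) else 0) ≠ 0 := by
      intro P _ y hy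
      rw [sum_boole, Nat.cast_ne_zero]
      exact (card_pos.2 ⟨y, by simpa using hy⟩).ne'
    have hqy : ∀ y, aeval (G.adjMatrix ℝ) q y x =
        c (i + 1) * (if G.dist x y = i + 1 then 1 else 0) := by
      intro y
      have h₁ : L (X * p * p) / L (p * p) * (if G.dist x y = i then 1 else 0) =
          a i * (if G.dist x y = i then 1 else 0) := by
        split_ifs with h
        · rw [ha, mul_div_cancel_right₀ _ (hpp ▸ sum_ne_zero _ y h)]
        · simp
      have h₂ : L (X * p * p₀) / L (p₀ * p₀) * (if G.dist x y + 1 = i then 1 else 0) =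
          b (i - 1) * (if G.dist x y + 1 = i then 1 else 0) := by
        split_ifs with h
        · rw [hb, mul_div_cancel_right₀ _ (hp₀p₀ ▸ sum_ne_zero _ y h)]
        · simp
      rw [hq, map_sub, map_sub, Matrix.sub_apply, Matrix.sub_apply, hXp, ← smul_eq_C_mul,
        ← smul_eq_C_mul, map_smul, map_smul, Matrix.smul_apply, Matrix.smul_apply, h, h₀,
        smul_eq_mul, smul_eq_mul, h₁, h₂]
      ring
    have hqq : L (q * q) =
        c (i + 1) * (c (i + 1) * ∑ y, if G.dist x y = i + 1 then (1 : ℝ) else 0) := by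
      rw [hLmul, mul_sum, mul_sum]
      refine sum_congr rfl fun y _ => ?_
      rw [hqy]
      by_cases h : G.dist x y = i + 1 <;> simp [h]
    -- The left side is `b i` times the size of sphere `i`. Dividing by `L (q * q)` leaves `1 / c (i
    -- + 1)` when sphere `i + 1` is non-empty.
    have hbi : (δ i - L (X * p * p) / L (p * p) - L (X * p * p₀) / L (p * p)) * L (p * p) =
        c (i + 1) * ∑ y, if G.dist x y = i + 1 then (1 : ℝ) else 0 := by
      rw [mul_comm (c (i + 1)), hx.sum_sphere_mul, ← hpp]
      by_cases hk : L (p * p) = 0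
      · simp [hk]
      · obtain ⟨y, hy⟩ : ∃ y, G.dist x y = i := by
          by_contra! hne
          exact hk (by simp [hpp, hne])
        rw [hc, ha, mul_div_cancel_right₀ _ hk, mul_div_cancel_right₀ _ hk, ← hy, ← hδ,
          hx.degree_eq]
        ring
    intro y
    rw [← smul_eq_C_mul, map_smul, Matrix.smul_apply, hqy, hqq, hbi, smul_eq_mul]
    by_cases h : G.dist x y = i + 1
    · have h₁ : c (i + 1) ≠ 0 := by
        rw [← h]
        refine (hx.c_pos y ?_).ne'
        rintro rfl
        simp at h
      have h₂ := sum_ne_zero (fun z => G.dist x z = i + 1) y h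
      simp only [h, if_true]
      field_simp
    · simp [h]

end SimpleGraph

/-! ### Degrees, the largest eigenvalue and closed walks -/

namespace SimpleGraph

open Polynomial Finset

/-- Edges sharing a vertex have equal values, and any two edges are joined by a walk. -/
theorem Connected.eq_of_adj_of_adj {V α : Type*} {G : SimpleGraph V} (hG : G.Connected)
    {f : V → V → α} (hsymm : ∀ x y, G.Adj x y → f x y = f y x)
    (h : ∀ x y z, G.Adj x y → G.Adj x z → f x y = f x z) {x y x' y' : V}
    (hxy : G.Adj x y) (hxy' : G.Adj x' y') : f x y = f x' y' := by
  obtain ⟨p⟩ := hG.preconnected x x'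
  induction p generalizing y with
  | nil => exact h _ _ _ hxy hxy'
  | cons hadj _ ih => rw [h _ _ _ hxy hadj, hsymm _ _ hadj, ih hadj.symm hxy']

variable {V W : Type*} [Fintype V] [Fintype W]
  {G : SimpleGraph V} [DecidableRel G.Adj] {H : SimpleGraph W} [DecidableRel H.Adj]

theorem IsDistanceRegularized.degree_eq_of_dist_eq (hG : G.IsDistanceRegularized) {x y z : V}
    (h : G.dist x y = G.dist x z) : G.degree y = G.degree z := by
  obtain ⟨c, a, b, hx⟩ := (hG.2 x).exists_hasIntersectionArray hG.1
  have : (G.degree y : ℝ) = G.degree z := by rw [hx.degree_eq, hx.degree_eq, h]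
  exact_mod_cast this

theorem IsDistanceRegularized.degree_mul_degree (hG : G.IsDistanceRegularized) {x y x' y' : V}
    (h : G.Adj x y) (h' : G.Adj x' y') :
    (G.degree x : ℝ) * G.degree y = G.degree x' * G.degree y' := by
  refine hG.1.eq_of_adj_of_adj (f := fun x y => (G.degree x : ℝ) * G.degree y)
    (fun x y _ => mul_comm _ _) (fun x y z hy hz => ?_) h h'
  rw [hG.degree_eq_of_dist_eq (x := x) (y := y) (z := z)
    (by rw [dist_eq_one_iff_adj.2 hy, dist_eq_one_iff_adj.2 hz])]

theorem IsDistanceRegularized.degree_add_degree (hG : G.IsDistanceRegularized) {x y x' y' : V}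
    (h : G.Adj x y) (h' : G.Adj x' y') :
    (G.degree x : ℝ) + G.degree y = G.degree x' + G.degree y' := by
  refine hG.1.eq_of_adj_of_adj (f := fun x y => (G.degree x : ℝ) + G.degree y)
    (fun x y _ => add_comm _ _) (fun x y z hy hz => ?_) h h'
  rw [hG.degree_eq_of_dist_eq (x := x) (y := y) (z := z)
    (by rw [dist_eq_one_iff_adj.2 hy, dist_eq_one_iff_adj.2 hz])]

/-- In a connected graph whose adjacent vertices have degrees with product `P`, the degrees
alternate with the distance from a fixed vertex. -/
theorem Connected.degree_eq_of_degree_mul_degree (hG : G.Connected) {P : ℝ} (hP : P ≠ 0)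
    (h : ∀ x y, G.Adj x y → (G.degree x : ℝ) * G.degree y = P) (x y : V) :
    (G.degree y : ℝ) =
      if Even (G.dist x y) then (G.degree x : ℝ) else P / G.degree x := by
  obtain ⟨p, hp⟩ := hG.exists_walk_length_eq_dist x y
  rw [← hp]
  clear hp
  induction p with
  | nil => simp
  | @cons x u _ hadj p ih =>
    have hP' := h _ _ hadj
    have hx : (G.degree x : ℝ) ≠ 0 := left_ne_zero_of_mul (hP'.symm ▸ hP)
    have hu : (G.degree u : ℝ) ≠ 0 := right_ne_zero_of_mul (hP'.symm ▸ hP)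
    rw [ih, Walk.length_cons, ← hP']
    by_cases he : Even p.length
    · simp [he, Nat.even_add_one, mul_div_cancel_left₀ _ hx]
    · simp [he, Nat.even_add_one, mul_div_cancel_right₀ _ hu]

/-- Sum `P * (1 / deg x + 1 / deg y) = S` over ordered edges: the reciprocals of the degrees at
either end add up to the number of vertices. -/
theorem two_mul_card_mul_eq {P S : ℝ} (hpos : ∀ x, G.degree x ≠ 0)
    (hP : ∀ x y, G.Adj x y → (G.degree x : ℝ) * G.degree y = P)
    (hS : ∀ x y, G.Adj x y → (G.degree x : ℝ) + G.degree y = S) :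
    2 * Fintype.card V * P = S * ∑ x, (G.degree x : ℝ) := by
  have h₁ : ∑ x, ∑ y ∈ G.neighborFinset x, (1 / (G.degree x : ℝ)) = Fintype.card V := by
    have : ∀ x, ∑ y ∈ G.neighborFinset x, (1 / (G.degree x : ℝ)) = 1 := fun x => by
      simp [hpos x]
    simp only [this, sum_const, card_univ, nsmul_eq_mul, mul_one]
  have h₂ : ∑ x, ∑ y ∈ G.neighborFinset x, (1 / (G.degree y : ℝ)) = Fintype.card V := by
    have := sum_mul_sum_neighborFinset (G := G) (fun _ => 1) fun x => 1 / (G.degree x : ℝ)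
    simp only [one_mul] at this
    rw [this, ← h₁]
    simp [mul_comm]
  have h₃ : ∑ x, ∑ y ∈ G.neighborFinset x, P * (1 / (G.degree x : ℝ) + 1 / G.degree y) =
      ∑ x, S * G.degree x := by
    refine sum_congr rfl fun x _ => ?_
    rw [sum_congr rfl (g := fun _ => S) fun y hy => ?_]
    · simp [mul_comm]
    · have hxy : G.Adj x y := by simpa using hy
      have hx : (G.degree x : ℝ) ≠ 0 := Nat.cast_ne_zero.2 (hpos x)
      have hy : (G.degree y : ℝ) ≠ 0 := Nat.cast_ne_zero.2 (hpos y)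
      rw [← hP x y hxy, ← hS x y hxy]
      field_simp
      ring
  rw [mul_sum, ← h₃]
  simp only [← mul_sum, sum_add_distrib]
  rw [h₁, h₂]
  ring

theorem mulVec_sqrt_degree {P : ℝ} (hpos : ∀ x, G.degree x ≠ 0)
    (hP : ∀ x y, G.Adj x y → (G.degree x : ℝ) * G.degree y = P) :
    (G.adjMatrix ℝ).mulVec (fun x => √(G.degree x)) = √P • fun x => √(G.degree x) := by
  ext x
  rw [adjMatrix_mulVec_apply, sum_congr rfl (g := fun _ => √P / √(G.degree x)) fun y hy => ?_]
  · have : (0 : ℝ) < G.degree x := Nat.cast_pos.2 (Nat.pos_of_ne_zero (hpos x))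
    have h := Real.mul_self_sqrt this.le
    have h' := (Real.sqrt_pos.2 this).ne'
    simp only [sum_const, card_neighborFinset_eq_degree, nsmul_eq_mul, Pi.smul_apply, smul_eq_mul]
    field_simp
    linear_combination -√P * h
  · have : (0 : ℝ) < G.degree x := Nat.cast_pos.2 (Nat.pos_of_ne_zero (hpos x))
    rw [← hP x y (by simpa using hy), Real.sqrt_mul this.le,
      mul_div_cancel_left₀ _ (Real.sqrt_pos.2 this).ne']

variable [DecidableEq V] [DecidableEq W]

theorem mem_graphSpectrum_iff {μ : ℝ} :
    μ ∈ G.graphSpectrum ↔ ∃ u : V → ℝ, u ≠ 0 ∧ (G.adjMatrix ℝ).mulVec u = μ • u := by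
  rw [graphSpectrum, mem_roots (Matrix.charpoly_monic _).ne_zero,
    ← Matrix.mem_spectrum_iff_isRoot_charpoly, ← Matrix.spectrum_toLin',
    ← Module.End.hasEigenvalue_iff_mem_spectrum]
  constructor
  · intro h
    obtain ⟨u, hu⟩ := h.exists_hasEigenvector
    exact ⟨u, hu.2, by simpa using hu.apply_eq_smul⟩
  · rintro ⟨u, hu, h⟩
    exact Module.End.hasEigenvalue_of_hasEigenvector
      ⟨Module.End.mem_eigenspace_iff.2 (by simpa using h), hu⟩

/-- A positive eigenvector belongs to an eigenvalue that bounds the absolute values of all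
eigenvalues. -/
theorem abs_le_of_mem_graphSpectrum {s : V → ℝ} {l : ℝ} (hs : ∀ x, 0 < s x)
    (h : (G.adjMatrix ℝ).mulVec s = l • s) {μ : ℝ} (hμ : μ ∈ G.graphSpectrum) : |μ| ≤ l := by
  obtain ⟨u, hu, hAu⟩ := mem_graphSpectrum_iff.1 hμ
  obtain ⟨x₀, hx₀⟩ := Function.ne_iff.1 hu
  have : Nonempty V := ⟨x₀⟩
  obtain ⟨x, hx⟩ := Finite.exists_max fun x => |u x| / s x
  have hux : 0 < |u x| := by
    have h₁ : 0 < |u x₀| / s x₀ := div_pos (abs_pos.2 hx₀) (hs x₀)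
    exact (div_pos_iff_of_pos_right (hs x)).1 (h₁.trans_le (hx x₀))
  refine le_of_mul_le_mul_right ?_ hux
  have h₁ := congrFun hAu x
  have h₂ := congrFun h x
  rw [adjMatrix_mulVec_apply, Pi.smul_apply, smul_eq_mul] at h₁ h₂
  calc |μ| * |u x| = |∑ z ∈ G.neighborFinset x, u z| := by rw [h₁, abs_mul]
    _ ≤ ∑ z ∈ G.neighborFinset x, |u z| := abs_sum_le_sum_abs _ _
    _ ≤ ∑ z ∈ G.neighborFinset x, |u x| / s x * s z :=
      sum_le_sum fun z _ => (div_le_iff₀ (hs z)).1 (hx z)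
    _ = l * |u x| := by
      rw [← mul_sum, h₂]
      field_simp [(hs x).ne']

/-- The positive eigenvector `√deg` shows that `√P` and `√Q` are the largest eigenvalues. -/
theorem Cospectral.degree_mul_degree_eq [Nonempty V] [Nonempty W] (h : G.Cospectral H)
    {P Q : ℝ} (hP₀ : 0 ≤ P) (hQ₀ : 0 ≤ Q)
    (hG : ∀ x, G.degree x ≠ 0) (hH : ∀ x, H.degree x ≠ 0)
    (hP : ∀ x y, G.Adj x y → (G.degree x : ℝ) * G.degree y = P)
    (hQ : ∀ x y, H.Adj x y → (H.degree x : ℝ) * H.degree y = Q) : P = Q := by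
  have hsG : ∀ x, 0 < √(G.degree x : ℝ) := fun x =>
    Real.sqrt_pos.2 (Nat.cast_pos.2 (Nat.pos_of_ne_zero (hG x)))
  have hsH : ∀ x, 0 < √(H.degree x : ℝ) := fun x =>
    Real.sqrt_pos.2 (Nat.cast_pos.2 (Nat.pos_of_ne_zero (hH x)))
  have hmG : √P ∈ G.graphSpectrum := mem_graphSpectrum_iff.2
    ⟨_, fun h => (hsG (Classical.arbitrary V)).ne' (congrFun h _), mulVec_sqrt_degree hG hP⟩
  have hmH : √Q ∈ H.graphSpectrum := mem_graphSpectrum_iff.2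
    ⟨_, fun h => (hsH (Classical.arbitrary W)).ne' (congrFun h _), mulVec_sqrt_degree hH hQ⟩
  have h₁ := abs_le_of_mem_graphSpectrum hsG (mulVec_sqrt_degree hG hP) (h.symm ▸ hmH)
  have h₂ := abs_le_of_mem_graphSpectrum hsH (mulVec_sqrt_degree hH hQ) (h ▸ hmG)
  rw [abs_of_nonneg (Real.sqrt_nonneg _)] at h₁ h₂
  exact (Real.sqrt_inj hP₀ hQ₀).1 (le_antisymm h₂ h₁)

theorem trace_aeval_X_mul_X :
    (aeval (G.adjMatrix ℝ) (X * X : ℝ[X])).trace = ∑ x, (G.degree x : ℝ) := by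
  rw [map_mul, aeval_X]
  exact sum_congr rfl fun x _ => G.adjMatrix_mul_self_apply_self x

/-- The number of closed walks of each positive length at a vertex of a distance-regularized graph
is proportional to its degree. -/
theorem IsDistanceRegularized.aeval_X_mul_apply_self (hG : G.IsDistanceRegularized) (p : ℝ[X])
    (x : V) : aeval (G.adjMatrix ℝ) (X * p) x x * ∑ y, (G.degree y : ℝ) =
      G.degree x * (aeval (G.adjMatrix ℝ) (X * p)).trace := by
  -- The entries of `p(A)` on edges are symmetric and depend only on distance around each vertex, so
  -- they are constant.
  obtain ⟨t, ht⟩ : ∃ t, ∀ x y, G.Adj x y → aeval (G.adjMatrix ℝ) p y x = t := by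
    by_cases he : ∃ x y, G.Adj x y
    · obtain ⟨x, y, hxy⟩ := he
      refine ⟨aeval (G.adjMatrix ℝ) p y x, fun x' y' h => ?_⟩
      refine hG.1.eq_of_adj_of_adj (f := fun x y => aeval (G.adjMatrix ℝ) p y x)
        (fun x y _ => aeval_adjMatrix_comm _ _ _) (fun x y z hy hz => ?_) h hxy
      obtain ⟨c, a, b, hx⟩ := (hG.2 x).exists_hasIntersectionArray hG.1
      obtain ⟨F, hF⟩ := hx.exists_aeval_eq hG.1 p
      simp only [hF, dist_eq_one_iff_adj.2 hy, dist_eq_one_iff_adj.2 hz]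
    · exact ⟨0, fun x y h => absurd ⟨x, y, h⟩ he⟩
  have key : ∀ x, aeval (G.adjMatrix ℝ) (X * p) x x = G.degree x * t := fun x => by
    rw [aeval_X_mul_apply, sum_congr rfl fun y hy => ht x y (by simpa using hy)]
    simp
  simp only [Matrix.trace, Matrix.diag_apply, key, ← sum_mul]
  ring

/-- Split off the constant term of `p`; the diagonal entry of the rest is the degree times a trace
over the degree sum, both spectral. -/
theorem Cospectral.aeval_apply_self_eq (hG : G.IsDistanceRegularized)
    (hH : H.IsDistanceRegularized) (h : G.Cospectral H) {x : V} {x' : W}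
    (hpos : G.degree x ≠ 0) (hx : G.degree x = H.degree x') (p : ℝ[X]) :
    aeval (G.adjMatrix ℝ) p x x = aeval (H.adjMatrix ℝ) p x' x' := by
  have htr := cospectral_iff_trace_aeval.1 h
  have hne : ∑ y, (G.degree y : ℝ) ≠ 0 := by
    refine (sum_pos' (fun _ _ => Nat.cast_nonneg _) ⟨x, mem_univ _, ?_⟩).ne'
    exact Nat.cast_pos.2 (Nat.pos_of_ne_zero hpos)
  have hX : ∀ q : ℝ[X], aeval (G.adjMatrix ℝ) (X * q) x x =
      aeval (H.adjMatrix ℝ) (X * q) x' x' := fun q => by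
    refine mul_right_cancel₀ hne ?_
    rw [hG.aeval_X_mul_apply_self, ← trace_aeval_X_mul_X, htr, htr, trace_aeval_X_mul_X,
      hH.aeval_X_mul_apply_self, hx]
  rw [← X_mul_divX_add p, map_add, map_add, Matrix.add_apply, Matrix.add_apply, hX]
  simp [Matrix.algebraMap_matrix_apply]

end SimpleGraph

/-! ### Intersection numbers and the three-pebble game -/

namespace SimpleGraph

open Polynomial Finset

theorem countingEquivalent_of_back_and_forth {V W : Type*} {G : SimpleGraph V}
    {H : SimpleGraph W} {R : (Fin 3 → V) → (Fin 3 → W) → Prop}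
    (hnon : ∃ v w, R v w)
    (h : ∀ φ : CountingFormula 3, ∀ v w, R v w → (φ.Holds G v ↔ φ.Holds H w)) :
    G.CountingEquivalent 3 H := by
  obtain ⟨v, w, hvw⟩ := hnon
  intro φ hφ
  rw [satisfies_iff_holds G hφ v, satisfies_iff_holds H hφ w, h φ v w hvw]

theorem countingEquivalent_of_subsingleton {V W : Type*} {G : SimpleGraph V}
    {H : SimpleGraph W} [Nonempty V] [Nonempty W] [Subsingleton V]
    [Subsingleton W] : G.CountingEquivalent 3 H := by
  inhabit V
  inhabit W
  have := Unique.mk' V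
  have := Unique.mk' W
  refine countingEquivalent_of_back_and_forth (R := fun _ _ => True)
    ⟨fun _ => default, fun _ => default, trivial⟩
    (CountingFormula.holds_iff_of_backAndForth G H _ ?_ ?_ ?_)
  · exact fun v w _ i j => iff_of_true (Subsingleton.elim _ _) (Subsingleton.elim _ _)
  · intro v w _ i j
    rw [Subsingleton.elim (v i) (v j), Subsingleton.elim (w i) (w j)]
    simp
  · exact fun v w _ i => ⟨Equiv.ofUnique V W, fun _ => trivial⟩

section

variable {V : Type*} [Fintype V] [DecidableEq V] {G : SimpleGraph V} [DecidableRel G.Adj]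

/-- The number of vertices at given distances from `x` and `y`, in terms of polynomials that map the
unit vectors at `x` and `y` to the indicator functions of spheres. -/
theorem IsDistanceRegularized.card_mul_aeval (hG : G.IsDistanceRegularized) {x y : V}
    {P Q : ℕ → ℝ[X]}
    (hP : ∀ i z, aeval (G.adjMatrix ℝ) (P i) z x = if G.dist x z = i then 1 else 0)
    (hQ : ∀ i z, aeval (G.adjMatrix ℝ) (Q i) z y = if G.dist y z = i then 1 else 0) (r s : ℕ) :
    (#{z | G.dist x z = r ∧ G.dist y z = s} : ℝ) *
        aeval (G.adjMatrix ℝ) (P (G.dist x y) * P (G.dist x y)) x x =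
      aeval (G.adjMatrix ℝ) (P (G.dist x y) * (P r * Q s)) x x := by
  obtain ⟨c, a, b, hx⟩ := (hG.2 x).exists_hasIntersectionArray hG.1
  obtain ⟨F, hF⟩ := hx.exists_aeval_eq hG.1 (P r * Q s)
  have hcard : (#{z | G.dist x z = r ∧ G.dist y z = s} : ℝ) = F (G.dist x y) := by
    rw [← hF, aeval_adjMatrix_comm, aeval_mul_apply, natCast_card_filter]
    refine sum_congr rfl fun z _ => ?_
    rw [hP, hQ, ite_and]
    split_ifs <;> simp
  -- Both sides equal `F (G.dist x y)` times the size of the sphere about `x` through `y`.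
  rw [hcard, aeval_mul_apply, aeval_mul_apply, mul_sum]
  refine sum_congr rfl fun z _ => ?_
  rw [hP, hF]
  split_ifs with h <;> simp [h]

theorem aeval_mul_self_pos {x y : V} {p : ℝ[X]} (h : aeval (G.adjMatrix ℝ) p y x ≠ 0) :
    0 < aeval (G.adjMatrix ℝ) (p * p) x x := by
  rw [aeval_mul_apply]
  exact sum_pos' (fun z _ => mul_self_nonneg _) ⟨y, mem_univ _, mul_self_pos.2 h⟩

end

variable {V W : Type*} [Fintype V] [Fintype W] {G : SimpleGraph V} {H : SimpleGraph W}

theorem exists_equiv_of_card_eq {x y : V} {x' y' : W}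
    (h : ∀ r s, #{z | G.dist x z = r ∧ G.dist y z = s} =
      #{z | H.dist x' z = r ∧ H.dist y' z = s}) :
    ∃ f : V ≃ W, ∀ z, G.dist x z = H.dist x' (f z) ∧ G.dist y z = H.dist y' (f z) := by
  have fiber : ∀ c : ℕ × ℕ, {z // (G.dist x z, G.dist y z) = c} ≃
      {z // (H.dist x' z, H.dist y' z) = c} := fun c => by
    refine Fintype.equivOfCardEq ?_
    simp only [Prod.ext_iff, Fintype.card_subtype]
    exact h c.1 c.2
  refine ⟨Equiv.ofFiberEquiv fiber, fun z => ?_⟩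
  simpa [eq_comm] using Equiv.ofFiberEquiv_map fiber z

variable [DecidableEq V] [DecidableEq W] [DecidableRel G.Adj] [DecidableRel H.Adj]

/-- `distPolyPair` uses only `L` and `δ`, which agree at `x` and `x'`, so the same polynomials serve
both graphs. -/
theorem IsDistanceRegularized.exists_distPoly (hG : G.IsDistanceRegularized)
    (hH : H.IsDistanceRegularized) {δ : ℕ → ℕ → ℝ}
    (hL : ∀ x x', G.degree x = H.degree x' → ∀ p : ℝ[X],
      aeval (G.adjMatrix ℝ) p x x = aeval (H.adjMatrix ℝ) p x' x')
    (hδG : ∀ x y, (G.degree y : ℝ) = δ (G.degree x) (G.dist x y))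
    (hδH : ∀ x y, (H.degree y : ℝ) = δ (H.degree x) (H.dist x y))
    {x : V} {x' : W} (hx : G.degree x = H.degree x') : ∃ P : ℕ → ℝ[X],
      (∀ i z, aeval (G.adjMatrix ℝ) (P i) z x = if G.dist x z = i then 1 else 0) ∧
      ∀ i z, aeval (H.adjMatrix ℝ) (P i) z x' = if H.dist x' z = i then 1 else 0 := by
  obtain ⟨c, a, b, h⟩ := (hG.2 x).exists_hasIntersectionArray hG.1
  obtain ⟨c', a', b', h'⟩ := (hH.2 x').exists_hasIntersectionArray hH.1
  exact ⟨fun i => (distPolyPair (fun p => aeval (G.adjMatrix ℝ) p x x) (δ (G.degree x)) i).2,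
    fun i => (h.aeval_distPolyPair hG.1 (fun _ => rfl) (hδG x) i).2,
    fun i => (h'.aeval_distPolyPair hH.1 (fun p => (hL x x' hx p).symm) (hx ▸ hδH x') i).2⟩

/-- Two distance-regularized graphs in which the closed walk counts and the degrees on spheres are
given by the same functions of the degree have the same intersection numbers. -/
theorem IsDistanceRegularized.card_eq (hG : G.IsDistanceRegularized)
    (hH : H.IsDistanceRegularized) {δ : ℕ → ℕ → ℝ}
    (hL : ∀ x x', G.degree x = H.degree x' → ∀ p : ℝ[X],
      aeval (G.adjMatrix ℝ) p x x = aeval (H.adjMatrix ℝ) p x' x')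
    (hδG : ∀ x y, (G.degree y : ℝ) = δ (G.degree x) (G.dist x y))
    (hδH : ∀ x y, (H.degree y : ℝ) = δ (H.degree x) (H.dist x y))
    {x y : V} {x' y' : W} (hx : G.degree x = H.degree x') (hy : G.degree y = H.degree y')
    (hxy : G.dist x y = H.dist x' y') (r s : ℕ) :
    #{z | G.dist x z = r ∧ G.dist y z = s} = #{z | H.dist x' z = r ∧ H.dist y' z = s} := by
  obtain ⟨P, hPG, hPH⟩ := hG.exists_distPoly hH hL hδG hδH hx
  obtain ⟨Q, hQG, hQH⟩ := hG.exists_distPoly hH hL hδG hδH hy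
  have h₁ := hG.card_mul_aeval hPG hQG r s
  have h₂ := hH.card_mul_aeval hPH hQH r s
  have h₀ := aeval_mul_self_pos (G := G) (x := x) (y := y) (p := P (G.dist x y)) (by simp [hPG])
  rw [hL x x' hx, hL x x' hx, hxy, ← h₂] at h₁
  rw [hL x x' hx, hxy] at h₀
  exact_mod_cast mul_right_cancel₀ h₀.ne' h₁

theorem IsDistanceRegularized.countingEquivalent (hG : G.IsDistanceRegularized)
    (hH : H.IsDistanceRegularized) {δ : ℕ → ℕ → ℝ}
    (hL : ∀ x x', G.degree x = H.degree x' → ∀ p : ℝ[X],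
      aeval (G.adjMatrix ℝ) p x x = aeval (H.adjMatrix ℝ) p x' x')
    (hδG : ∀ x y, (G.degree y : ℝ) = δ (G.degree x) (G.dist x y))
    (hδH : ∀ x y, (H.degree y : ℝ) = δ (H.degree x) (H.dist x y))
    (hdeg : ∃ x x', G.degree x = H.degree x') : G.CountingEquivalent 3 H := by
  obtain ⟨x₀, x₀', h₀⟩ := hdeg
  refine countingEquivalent_of_back_and_forth (R := fun v w =>
    (∀ i j, G.dist (v i) (v j) = H.dist (w i) (w j)) ∧ ∀ i, G.degree (v i) = H.degree (w i))
    ⟨fun _ => x₀, fun _ => x₀', by simp, fun _ => h₀⟩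
    (CountingFormula.holds_iff_of_backAndForth G H _ ?_ ?_ ?_)
  · intro v w h i j
    rw [← hG.1.dist_eq_zero_iff, h.1, hH.1.dist_eq_zero_iff]
  · intro v w h i j
    rw [← dist_eq_one_iff_adj, h.1, dist_eq_one_iff_adj]
  · intro v w h i
    -- Only two pebbles stay in place, so the counts for pairs of vertices suffice.
    obtain ⟨j, l, hj, hl, hjl⟩ : ∃ j l : Fin 3, j ≠ i ∧ l ≠ i ∧ ∀ m, m = i ∨ m = j ∨ m = l := by
      decide +revert
    obtain ⟨f, hf⟩ := exists_equiv_of_card_eq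
      (hG.card_eq hH hL hδG hδH (h.2 j) (h.2 l) (h.1 j l))
    have hdist : ∀ a m, m ≠ i → G.dist (v m) a = H.dist (w m) (f a) := by
      intro a m hm
      rcases hjl m with rfl | rfl | rfl
      · exact absurd rfl hm
      · exact (hf a).1
      · exact (hf a).2
    refine ⟨f, fun a => ⟨fun m n => ?_, fun m => ?_⟩⟩
    · by_cases hm : m = i <;> by_cases hn : n = i
      · simp [hm, hn]
      · simp [hm, hn, dist_comm (u := a), dist_comm (u := f a), hdist a n hn]
      · simp [hm, hn, hdist a m hm]
      · simp [hm, hn, h.1]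
    · by_cases hm : m = i
      -- The degree of the new vertex is determined by its distance from `v j` and the degree there.
      · have := hδG (v j) a
        rw [hdist a j hj, h.2 j, ← hδH] at this
        rw [hm, Function.update_self, Function.update_self]
        exact_mod_cast this
      · rw [Function.update_of_ne hm, Function.update_of_ne hm, h.2]

theorem Cospectral.card_eq (h : G.Cospectral H) : Fintype.card V = Fintype.card W := by
  simpa using cospectral_iff_trace_aeval.1 h 1

theorem Cospectral.sum_degree_eq (h : G.Cospectral H) :
    ∑ x, (G.degree x : ℝ) = ∑ x, (H.degree x : ℝ) := by
  rw [← trace_aeval_X_mul_X, ← trace_aeval_X_mul_X, cospectral_iff_trace_aeval.1 h]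

theorem Cospectral.countingEquivalent (h : G.Cospectral H) (hG : G.IsDistanceRegularized)
    (hH : H.IsDistanceRegularized) : G.CountingEquivalent 3 H := by
  have := hG.1.nonempty
  have := hH.1.nonempty
  have hcard := h.card_eq
  -- A single vertex has degree zero, which the degree arguments exclude.
  rcases subsingleton_or_nontrivial V with hV | hV
  · have : Subsingleton W := by
      rw [← Fintype.card_le_one_iff_subsingleton, ← hcard]
      exact Fintype.card_le_one_iff_subsingleton.2 hV
    exact countingEquivalent_of_subsingleton
  have hW : Nontrivial W := by
    rw [← Fintype.one_lt_card_iff_nontrivial, ← hcard]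
    exact Fintype.one_lt_card
  have hGpos : ∀ x, G.degree x ≠ 0 := fun x => (hG.1.preconnected.degree_pos_of_nontrivial x).ne'
  have hHpos : ∀ x, H.degree x ≠ 0 := fun x => (hH.1.preconnected.degree_pos_of_nontrivial x).ne'
  obtain ⟨x, y, hxy⟩ : ∃ x y, G.Adj x y := by
    obtain ⟨y, hy⟩ := (G.degree_pos_iff_exists_adj (Classical.arbitrary V)).1
      (Nat.pos_of_ne_zero (hGpos _))
    exact ⟨_, y, hy⟩
  obtain ⟨x', y', hxy'⟩ : ∃ x y, H.Adj x y := by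
    obtain ⟨y, hy⟩ := (H.degree_pos_iff_exists_adj (Classical.arbitrary W)).1
      (Nat.pos_of_ne_zero (hHpos _))
    exact ⟨_, y, hy⟩
  have hPG := fun u z (huz : G.Adj u z) => hG.degree_mul_degree huz hxy
  have hPH := fun u z (huz : H.Adj u z) => hH.degree_mul_degree huz hxy'
  have hP : (G.degree x : ℝ) * G.degree y = H.degree x' * H.degree y' :=
    h.degree_mul_degree_eq (by positivity) (by positivity) hGpos hHpos hPG hPH
  have hP₀ : (G.degree x : ℝ) * G.degree y ≠ 0 :=
    mul_ne_zero (Nat.cast_ne_zero.2 (hGpos x)) (Nat.cast_ne_zero.2 (hGpos y))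
  have hS : (G.degree x : ℝ) + G.degree y = H.degree x' + H.degree y' := by
    have h₁ := two_mul_card_mul_eq hGpos hPG fun u z huz => hG.degree_add_degree huz hxy
    have h₂ := two_mul_card_mul_eq hHpos hPH fun u z huz => hH.degree_add_degree huz hxy'
    rw [hcard, hP, h₂, h.sum_degree_eq] at h₁
    refine (mul_right_cancel₀ ?_ h₁).symm
    refine (sum_pos (fun z _ => ?_) univ_nonempty).ne'
    exact Nat.cast_pos.2 (Nat.pos_of_ne_zero (hHpos z))
  refine hG.countingEquivalent hH (δ := fun k i =>
      if Even i then (k : ℝ) else (G.degree x : ℝ) * G.degree y / k)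
    (fun u u' hu p => h.aeval_apply_self_eq hG hH (hGpos u) hu p)
    (hG.1.degree_eq_of_degree_mul_degree hP₀ hPG)
    (hH.1.degree_eq_of_degree_mul_degree hP₀ fun u z huz => (hPH u z huz).trans hP.symm) ?_
  -- Equal sums and products make `deg x` a root of the quadratic with roots `deg x'` and `deg y'`.
  have : ((G.degree x : ℝ) - H.degree x') * (G.degree x - H.degree y') = 0 := by
    linear_combination (G.degree x : ℝ) * hS - hP
  rcases mul_eq_zero.1 this with h | h
  · exact ⟨x, x', by exact_mod_cast sub_eq_zero.1 h⟩
  · exact ⟨x, y', by exact_mod_cast sub_eq_zero.1 h⟩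

end SimpleGraph

theorem mainTheorem2 {V W : Type*} [Fintype V] [DecidableEq V] [Fintype W] [DecidableEq W]
    (G : SimpleGraph V) [DecidableRel G.Adj] (H : SimpleGraph W) [DecidableRel H.Adj]
    (hG : G.IsDistanceRegularized) (hH : H.IsDistanceRegularized) :
    G.Cospectral H ↔ G.CountingEquivalent 3 H := by
  have := hG.1.nonempty
  have := hH.1.nonempty
  exact ⟨fun h => h.countingEquivalent hG hH, fun h => h.cospectral⟩
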